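/- For a positive integer $m$, let $\sigma_0(m)$ denote the number of positive divisors of $m$. Let $(A,B)\in\{(16,14),(36,30),(72,42),(196,70),(252,114)\}$ and let $N=An+B$ for some nonnegative integer $n$. Then $$\sum_{1\le k<\sqrt{N}}\sigma_0(N-k^2)\equiv 0\pmod 4,$$ where the sum runs over the integers $k$ with $1\le k<\sqrt{N}$. -/

import Mathlib

open scoped ArithmeticFunction.sigma

/-! Only two properties of `N` matter: `N ≡ 2 (mod 4)` and `N` is not a sum of two squares. Every
term is then even, and half of it is needed only modulo 2. For even `k`, `N - k² = 2l` with `l` odd,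
so half the term is `σ 0 l`, which is odd exactly when `l` is a square. For odd `k`, `m = N - k²` is
a nonsquare with `m ≡ 1 (mod 4)`; half the term counts the divisors below `√m`. These are the fixed
points of Zagier's involution on `x² + 4yz = m`, so swapping `y` and `z` turns the parity into that
of the representations `m = x² + 4y²`. Half the sum thus counts the solutions of `k² + x² + 4y² = N`
with `k` odd and of `k² + 2x² = N` with `k` even. Swapping `k` and `x` pairs the former except where
`k = x`; those satisfy `2x² + (2y)² = N` and match the latter. -/

/-- An involution of a finite set fixes as many points as the set has, modulo 2. -/
theorem Finset.card_modEq_card_fixed {α : Type*} [DecidableEq α] (s : Finset α) (g : α → α)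
    (hg : ∀ a ∈ s, g a ∈ s) (hgg : ∀ a ∈ s, g (g a) = a) :
    s.card ≡ (s.filter fun a => g a = a).card [MOD 2] := by
  have h : ∑ a ∈ s, (if g a = a then (0 : ZMod 2) else 1) = 0 := by
    refine Finset.sum_involution (fun a _ => g a) ?_ ?_ hg hgg
    · intro a ha
      rw [hgg a ha]
      by_cases h : g a = a
      · simp [h]
      · simp only [h, Ne.symm h, if_false]
        decide
    · intro a _ h1 h2
      simp [h2] at h1
  rw [← ZMod.natCast_eq_natCast_iff, ← Finset.card_filter_add_card_filter_not (s := s) (fun a => g a = a)]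
  have h' : (((s.filter fun a => ¬ g a = a).card : ℕ) : ZMod 2) = 0 := by
    rw [← h, Finset.card_filter]
    push_cast
    exact Finset.sum_congr rfl fun a _ => by split_ifs <;> simp_all
  rw [Nat.cast_add, h', add_zero]

/-- The number of divisors is odd exactly for squares. -/
theorem sigma_zero_modEq_card_sqrt (m M : ℕ) (hm : 0 < m) (hM : m ≤ M) :
    σ 0 m ≡ ((Finset.Icc 1 M).filter fun x => x ^ 2 = m).card [MOD 2] := by
  rw [ArithmeticFunction.sigma_zero_apply]
  refine (Finset.card_modEq_card_fixed m.divisors (fun d => m / d) ?_ ?_).trans ?_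
  · intro a ha
    simp only [Nat.mem_divisors] at ha ⊢
    exact ⟨Nat.div_dvd_of_dvd ha.1, ha.2⟩
  · intro a ha
    simp only [Nat.mem_divisors] at ha
    exact Nat.div_div_self ha.1 ha.2
  · refine congrArg (· % 2) (congrArg Finset.card ?_)
    ext x
    simp only [Finset.mem_filter, Nat.mem_divisors, Finset.mem_Icc]
    constructor
    · rintro ⟨⟨h1, h2⟩, h3⟩
      have := Nat.mul_div_cancel' h1
      rw [h3] at this
      have hx : 0 < x := Nat.pos_of_dvd_of_pos h1 hm
      exact ⟨⟨hx, (Nat.le_of_dvd hm h1).trans hM⟩, by rw [sq, this]⟩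
    · rintro ⟨⟨h1, h2⟩, rfl⟩
      exact ⟨⟨Dvd.intro_left _ (by ring), hm.ne'⟩, by rw [sq, Nat.mul_div_cancel _ h1]⟩

/-! ### Zagier's involution and divisors modulo 4 -/

/-- Zagier's windmill involution on the solutions of `x² + 4yz = m`. -/
def windmillInvolution (t : ℕ × ℕ × ℕ) : ℕ × ℕ × ℕ :=
  if t.1 + t.2.2 < t.2.1 then (t.1 + 2 * t.2.2, t.2.2, t.2.1 - t.1 - t.2.2)
  else if t.1 < 2 * t.2.1 then (2 * t.2.1 - t.1, t.2.1, t.1 + t.2.2 - t.2.1)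
  else (t.1 - 2 * t.2.1, t.1 + t.2.2 - t.2.1, t.2.1)

/-- The positive solutions of `x² + 4yz = m`. -/
def windmills (m : ℕ) : Finset (ℕ × ℕ × ℕ) :=
  (Finset.Icc 1 m ×ˢ Finset.Icc 1 m ×ˢ Finset.Icc 1 m).filter
    fun t => t.1 ^ 2 + 4 * (t.2.1 * t.2.2) = m

theorem mem_windmills {m x y z : ℕ} :
    (x, y, z) ∈ windmills m ↔ 0 < x ∧ 0 < y ∧ 0 < z ∧ x ^ 2 + 4 * (y * z) = m := by
  simp only [windmills, Finset.mem_filter, Finset.mem_product, Finset.mem_Icc]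
  constructor
  · rintro ⟨⟨⟨h1, _⟩, ⟨h2, _⟩, ⟨h3, _⟩⟩, h⟩
    exact ⟨h1, h2, h3, h⟩
  · rintro ⟨h1, h2, h3, h⟩
    refine ⟨⟨⟨h1, ?_⟩, ⟨h2, ?_⟩, ⟨h3, ?_⟩⟩, h⟩ <;> nlinarith

/-- For a windmill of an odd nonsquare, the case distinctions of the involution are strict. -/
theorem windmills_generic {m x y z : ℕ} (hodd : m % 2 = 1) (hsq : ∀ x, x ^ 2 ≠ m)
    (h : x ^ 2 + 4 * (y * z) = m) : x + z ≠ y ∧ x ≠ 2 * y := by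
  refine ⟨?_, ?_⟩
  · rintro rfl
    exact hsq (x + 2 * z) (by rw [← h]; ring)
  · rintro rfl
    have : m = 2 * (2 * y ^ 2 + 2 * (y * z)) := by rw [← h]; ring
    omega

theorem windmillInvolution_mem {m : ℕ} (hodd : m % 2 = 1) (hsq : ∀ x, x ^ 2 ≠ m)
    (t : ℕ × ℕ × ℕ) (ht : t ∈ windmills m) : windmillInvolution t ∈ windmills m := by
  obtain ⟨x, y, z⟩ := t
  rw [mem_windmills] at ht
  obtain ⟨hx, hy, hz, h⟩ := ht
  obtain ⟨g1, g2⟩ := windmills_generic hodd hsq h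
  unfold windmillInvolution
  dsimp only
  split_ifs with c1 c2
  · obtain ⟨w, rfl⟩ := Nat.exists_eq_add_of_lt c1
    rw [mem_windmills, show x + z + w + 1 - x - z = w + 1 by omega]
    refine ⟨by omega, hz, by omega, ?_⟩
    rw [← h]; ring
  · obtain ⟨w, hw⟩ := Nat.exists_eq_add_of_lt c2
    obtain ⟨v, hv⟩ := Nat.exists_eq_add_of_lt (show y < x + z by omega)
    rw [mem_windmills, show 2 * y - x = w + 1 by omega, show x + z - y = v + 1 by omega]
    refine ⟨by omega, hy, by omega, ?_⟩
    rw [← h]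
    zify at hw hv ⊢
    rw [show (w : ℤ) = 2 * y - x - 1 by linarith, show (v : ℤ) = x + z - y - 1 by linarith]
    ring
  · obtain ⟨w, rfl⟩ := Nat.exists_eq_add_of_lt (show 2 * y < x by omega)
    rw [mem_windmills, show 2 * y + w + 1 - 2 * y = w + 1 by omega,
      show 2 * y + w + 1 + z - y = y + w + 1 + z by omega]
    refine ⟨by omega, by omega, hy, ?_⟩
    rw [← h]; ring

theorem windmillInvolution_involutive {m : ℕ} (hodd : m % 2 = 1) (hsq : ∀ x, x ^ 2 ≠ m)
    (t : ℕ × ℕ × ℕ) (ht : t ∈ windmills m) : windmillInvolution (windmillInvolution t) = t := by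
  obtain ⟨x, y, z⟩ := t
  rw [mem_windmills] at ht
  obtain ⟨hx, hy, hz, h⟩ := ht
  obtain ⟨g1, g2⟩ := windmills_generic hodd hsq h
  by_cases c1 : x + z < y
  · obtain ⟨w, rfl⟩ := Nat.exists_eq_add_of_lt c1
    simp only [windmillInvolution]
    rw [if_pos c1, if_neg (by dsimp only; omega), if_neg (by dsimp only; omega)]
    refine Prod.ext ?_ (Prod.ext ?_ ?_) <;> dsimp only <;> omega
  · by_cases c2 : x < 2 * y
    · simp only [windmillInvolution]
      rw [if_neg c1, if_pos c2, if_neg (by dsimp only; omega), if_pos (by dsimp only; omega)]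
      refine Prod.ext ?_ (Prod.ext ?_ ?_) <;> dsimp only <;> omega
    · simp only [windmillInvolution]
      rw [if_neg c1, if_neg c2, if_pos (by dsimp only; omega)]
      refine Prod.ext ?_ (Prod.ext ?_ ?_) <;> dsimp only <;> omega

/-- The points fixed by Zagier's involution correspond to the divisors below the square root. -/
theorem card_fixed_windmills {m : ℕ} (hm : m % 4 = 1) :
    ((windmills m).filter fun t => windmillInvolution t = t).card
      = (m.divisors.filter fun d => d < m / d).card := by
  -- Only the middle branch can fix a point: the outer two change `x` by `2z` or `2y`.
  have hfix : ∀ x y z, 0 < y → 0 < z → windmillInvolution (x, y, z) = (x, y, z) → y = x := by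
    intro x y z hy hz h
    unfold windmillInvolution at h
    dsimp only at h
    split_ifs at h <;> simp only [Prod.mk.injEq] at h <;> omega
  have hquot : ∀ x z, 0 < x → x ^ 2 + 4 * (x * z) = m → m = x * (x + 4 * z) ∧ m / x = x + 4 * z := by
    intro x z hx h
    have h' : m = x * (x + 4 * z) := by rw [← h]; ring
    exact ⟨h', Nat.div_eq_of_eq_mul_right hx h'⟩
  refine Finset.card_bij' (fun t _ => t.1) (fun d _ => (d, d, (m / d - d) / 4)) ?_ ?_ ?_ ?_
  all_goals simp only [Finset.mem_filter, Nat.mem_divisors, Prod.forall, mem_windmills]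
  · rintro x y z ⟨⟨hx, hy, hz, h⟩, hf⟩
    obtain rfl := hfix x y z hy hz hf
    obtain ⟨h1, h2⟩ := hquot y z hx h
    exact ⟨⟨⟨_, h1⟩, by omega⟩, by omega⟩
  · rintro d ⟨⟨⟨e, rfl⟩, h0⟩, hlt⟩
    have hd : 0 < d := Nat.pos_of_ne_zero (left_ne_zero_of_mul h0)
    rw [Nat.mul_div_cancel_left _ hd] at hlt ⊢
    -- Units modulo 4 are their own inverses, so `d * e ≡ 1` forces `d ≡ e`.
    have hmod : e % 4 = d % 4 := by
      rw [Nat.mul_mod] at hm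
      have h1 := Nat.mod_lt d (show 4 > 0 by norm_num)
      have h2 := Nat.mod_lt e (show 4 > 0 by norm_num)
      generalize d % 4 = a at *
      generalize e % 4 = b at *
      interval_cases a <;> interval_cases b <;> simp_all
    obtain ⟨w, rfl⟩ : ∃ w, e = d + 4 * w := ⟨(e - d) / 4, by omega⟩
    rw [show (d + 4 * w - d) / 4 = w by omega]
    refine ⟨⟨hd, hd, by omega, by ring⟩, ?_⟩
    unfold windmillInvolution
    dsimp only
    rw [if_neg (by omega), if_pos (by omega)]
    refine Prod.ext ?_ (Prod.ext ?_ ?_) <;> dsimp only <;> omega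
  · rintro x y z ⟨⟨hx, hy, hz, h⟩, hf⟩
    obtain rfl := hfix x y z hy hz hf
    rw [(hquot y z hx h).2, show (y + 4 * z - y) / 4 = z by omega]
  · intros; trivial

/-- A nonsquare has twice as many divisors as it has divisors below the square root. -/
theorem sigma_zero_eq_two_mul_card {m : ℕ} (hsq : ∀ x, x ^ 2 ≠ m) :
    σ 0 m = 2 * (m.divisors.filter fun d => d < m / d).card := by
  rw [ArithmeticFunction.sigma_zero_apply,
    ← Finset.card_filter_add_card_filter_not (s := m.divisors) (fun d => d < m / d), two_mul]
  congr 1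
  refine Finset.card_bij' (fun d _ => m / d) (fun d _ => m / d) ?_ ?_ ?_ ?_
  all_goals
    intro d hd
    simp only [Finset.mem_filter, Nat.mem_divisors] at hd ⊢
    obtain ⟨⟨hd, hm⟩, hlt⟩ := hd
  · have : d ≠ m / d := fun h => hsq d (by
      rw [sq]; nth_rewrite 2 [h]; exact Nat.mul_div_cancel' hd)
    rw [Nat.div_div_self hd hm]
    exact ⟨⟨Nat.div_dvd_of_dvd hd, hm⟩, by omega⟩
  · rw [Nat.div_div_self hd hm]
    exact ⟨⟨Nat.div_dvd_of_dvd hd, hm⟩, by omega⟩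
  · exact Nat.div_div_self hd hm
  · exact Nat.div_div_self hd hm

/-- The points fixed by `(x, y, z) ↦ (x, z, y)` are the representations `m = x² + 4y²`. -/
theorem card_windmills_modEq (m M : ℕ) (hM : m ≤ M) :
    (windmills m).card ≡ ((Finset.Icc 1 M ×ˢ Finset.Icc 1 M).filter
      fun p => p.1 ^ 2 + 4 * p.2 ^ 2 = m).card [MOD 2] := by
  refine (Finset.card_modEq_card_fixed (windmills m) (fun t => (t.1, t.2.2, t.2.1)) ?_ ?_).trans ?_
  · rintro ⟨x, y, z⟩ h
    rw [mem_windmills] at h ⊢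
    exact ⟨h.1, h.2.2.1, h.2.1, by rw [← h.2.2.2]; ring⟩
  · intro t _
    rfl
  · refine congrArg (· % 2) ?_
    refine Finset.card_bij' (fun t _ => (t.1, t.2.1)) (fun p _ => (p.1, p.2, p.2)) ?_ ?_ ?_ ?_
    all_goals
      simp only [Finset.mem_filter, Prod.forall, mem_windmills, Prod.mk.injEq, Finset.mem_product,
        Finset.mem_Icc, true_and, and_true]
    · rintro x y z ⟨⟨hx, hy, hz, h⟩, rfl, -⟩
      refine ⟨⟨⟨hx, ?_⟩, hy, ?_⟩, ?_⟩ <;> nlinarith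
    · rintro x y ⟨⟨⟨hx, -⟩, hy, -⟩, h⟩
      exact ⟨hx, hy, hy, by rw [← h]; ring⟩
    · rintro x y z ⟨-, h, -⟩
      exact h.symm
    · intros; trivial

/-- The number of divisors of a nonsquare `m ≡ 1 (mod 4)` is congruent modulo 4 to twice the number
of representations `m = x² + 4y²`. -/
theorem sigma_zero_modEq_two_mul_card (m M : ℕ) (hM : m ≤ M) (hm : m % 4 = 1)
    (hsq : ∀ x, x ^ 2 ≠ m) :
    σ 0 m ≡ 2 * ((Finset.Icc 1 M ×ˢ Finset.Icc 1 M).filter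
      fun p => p.1 ^ 2 + 4 * p.2 ^ 2 = m).card [MOD 4] := by
  have hodd : m % 2 = 1 := by omega
  rw [sigma_zero_eq_two_mul_card hsq, ← card_fixed_windmills hm]
  exact Nat.ModEq.mul_left' 2
    ((Finset.card_modEq_card_fixed _ _ (windmillInvolution_mem hodd hsq)
      (windmillInvolution_involutive hodd hsq)).symm.trans (card_windmills_modEq m M hM))

/-- The number of divisors of `2m` with `m` odd is congruent modulo 4 to twice the number of
positive square roots of `m`. -/
theorem sigma_zero_two_mul_modEq (m M : ℕ) (hM : m ≤ M) (hm : m % 2 = 1) :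
    σ 0 (2 * m) ≡ 2 * ((Finset.Icc 1 M).filter fun x => x ^ 2 = m).card [MOD 4] := by
  have hc : Nat.Coprime 2 m := (Nat.coprime_two_left).2 (Nat.odd_iff.2 hm)
  rw [ArithmeticFunction.isMultiplicative_sigma.map_mul_of_coprime hc,
    show σ 0 2 = 2 by decide]
  exact Nat.ModEq.mul_left' 2 (sigma_zero_modEq_card_sqrt m M (by omega) hM)

/-! ### Parity of the total count -/

/-- The pairs `(x, y)` contributing to the divisor count of `N - k²`. -/
def contributions (N k : ℕ) : Finset (ℕ × ℕ) :=
  -- For even `k` a single root `x` is stored as the diagonal pair `(x, x)`.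
  (Finset.Icc 1 N ×ˢ Finset.Icc 1 N).filter fun p =>
    if k % 2 = 1 then k ^ 2 + (p.1 ^ 2 + 4 * p.2 ^ 2) = N else p.1 = p.2 ∧ k ^ 2 + 2 * p.1 ^ 2 = N

/-- Splits on the parity of `k`. The assumption on sums of two squares is needed for odd `k`, to
make `N - k²` a nonsquare. -/
theorem sigma_zero_sub_sq_modEq {N k : ℕ} (hN : N % 4 = 2) (hsq : ∀ x y, x ^ 2 + y ^ 2 ≠ N)
    (hk : k ^ 2 < N) : σ 0 (N - k ^ 2) ≡ 2 * (contributions N k).card [MOD 4] := by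
  unfold contributions
  obtain ⟨m, rfl⟩ := Nat.exists_eq_add_of_lt hk
  rw [add_assoc] at *
  generalize m + 1 = m at *
  rw [Nat.add_sub_cancel_left]
  rcases Nat.even_or_odd' k with ⟨j, rfl | rfl⟩
  · obtain ⟨l, rfl⟩ : ∃ l, m = 2 * l := ⟨m / 2, by rw [mul_pow] at hN; omega⟩
    refine (sigma_zero_two_mul_modEq l ((2 * j) ^ 2 + 2 * l) (by omega)
      (by rw [mul_pow] at hN; omega)).trans (congrArg (fun c => 2 * c % 4) ?_)
    refine Finset.card_bij' (fun x _ => (x, x)) (fun p _ => p.1) ?_ ?_ ?_ ?_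
    all_goals
      simp only [Finset.mem_filter, Prod.forall, Finset.mem_product, Nat.mul_mod_right,
        zero_ne_one, if_false, Prod.mk.injEq, true_and]
    · rintro x ⟨hx, rfl⟩
      exact ⟨⟨hx, hx⟩, rfl⟩
    · rintro x y ⟨⟨hx, -⟩, -, h⟩
      exact ⟨hx, by omega⟩
    · intros; trivial
    · rintro x y ⟨-, h, -⟩
      exact h
  · have hm : m % 4 = 1 := by
      have : (2 * j + 1) ^ 2 = 4 * (j ^ 2 + j) + 1 := by ring
      omega
    refine (sigma_zero_modEq_two_mul_card m ((2 * j + 1) ^ 2 + m) (by omega) hm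
      fun x hx => hsq (2 * j + 1) x (by rw [hx])).trans (congrArg (fun c => 2 * c % 4) ?_)
    refine congrArg Finset.card (Finset.filter_congr fun p _ => ?_)
    rw [if_pos (by omega), Nat.add_left_cancel_iff]

/-- All contributions together cancel in pairs. -/
theorem sum_card_contributions_even {N : ℕ} (hN : N % 4 = 2) :
    ∑ k ∈ Finset.Icc 1 N, (contributions N k).card ≡ 0 [MOD 2] := by
  let C := (Finset.Icc 1 N ×ˢ Finset.Icc 1 N ×ˢ Finset.Icc 1 N).filter
    fun t => t.2 ∈ contributions N t.1
  have hC : ∑ k ∈ Finset.Icc 1 N, (contributions N k).card = C.card := by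
    rw [Finset.card_filter, Finset.sum_product]
    refine Finset.sum_congr rfl fun k _ => ?_
    rw [← Finset.card_filter]
    refine congrArg Finset.card ?_
    ext p
    simp only [contributions, Finset.mem_filter]
    tauto
  have hmem : ∀ k x y, (k, x, y) ∈ C ↔ 0 < k ∧ 0 < x ∧ 0 < y ∧
      (k % 2 = 1 ∧ k ^ 2 + (x ^ 2 + 4 * y ^ 2) = N ∨
        k % 2 = 0 ∧ x = y ∧ k ^ 2 + 2 * x ^ 2 = N) := by
    intro k x y
    simp only [C, contributions, Finset.mem_filter, Finset.mem_product, Finset.mem_Icc]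
    constructor
    · rintro ⟨⟨⟨hk, -⟩, ⟨hx, -⟩, hy, -⟩, -, h⟩
      refine ⟨hk, hx, hy, ?_⟩
      split_ifs at h with hodd
      · exact Or.inl ⟨hodd, h⟩
      · exact Or.inr ⟨by omega, h⟩
    · rintro ⟨hk, hx, hy, h⟩
      have hb : k ≤ N ∧ x ≤ N ∧ y ≤ N := by
        rcases h with ⟨-, h⟩ | ⟨-, rfl, h⟩
        · refine ⟨?_, ?_, ?_⟩ <;> nlinarith
        · refine ⟨?_, ?_, ?_⟩ <;> nlinarith
      refine ⟨⟨⟨hk, hb.1⟩, ⟨hx, hb.2.1⟩, hy, hb.2.2⟩, ⟨⟨hx, hb.2.1⟩, hy, hb.2.2⟩, ?_⟩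
      rcases h with ⟨hk, h⟩ | ⟨hk, h⟩
      · rwa [if_pos hk]
      · rwa [if_neg (by omega)]
  have hsq2 : ∀ x : ℕ, x % 2 = 0 ∧ x ^ 2 % 4 = 0 ∨ x % 2 = 1 ∧ x ^ 2 % 4 = 1 := by
    intro x
    rcases Nat.even_or_odd' x with ⟨j, rfl | rfl⟩
    · left
      have : (2 * j) ^ 2 = 4 * j ^ 2 := by ring
      omega
    · right
      have : (2 * j + 1) ^ 2 = 4 * (j ^ 2 + j) + 1 := by ring
      omega
  have hodd : ∀ k x y, (k, x, y) ∈ C → x % 2 = 1 := by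
    intro k x y h
    rw [hmem] at h
    have := hsq2 k
    have := hsq2 x
    omega
  -- a fixed-point-free involution
  let g : ℕ × ℕ × ℕ → ℕ × ℕ × ℕ := fun t =>
    if t.1 % 2 = 0 then (t.2.1, t.2.1, t.1 / 2)
    else if t.1 = t.2.1 then (2 * t.2.2, t.1, t.1) else (t.2.1, t.1, t.2.2)
  rw [hC]
  refine (Finset.card_modEq_card_fixed C g ?_ ?_).trans ?_
  · rintro ⟨k, x, y⟩ ht
    have hx := hodd k x y ht
    rw [hmem] at ht
    obtain ⟨hk0, hx0, hy0, h⟩ := ht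
    simp only [g]
    split_ifs with h1 h2
    · obtain ⟨j, rfl⟩ : ∃ j, k = 2 * j := ⟨k / 2, by omega⟩
      rw [hmem, Nat.mul_div_cancel_left _ two_pos]
      have : (2 * j) ^ 2 = 4 * j ^ 2 := by ring
      omega
    · subst h2
      rw [hmem]
      have : (2 * y) ^ 2 = 4 * y ^ 2 := by ring
      omega
    · rw [hmem]
      omega
  · rintro ⟨k, x, y⟩ ht
    have hx := hodd k x y ht
    rw [hmem] at ht
    obtain ⟨hk0, hx0, hy0, h⟩ := ht
    simp only [g]
    by_cases h1 : k % 2 = 0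
    · rw [if_pos h1, if_neg (by dsimp only; omega), if_pos rfl]
      refine Prod.ext ?_ (Prod.ext ?_ ?_) <;> dsimp only <;> omega
    · by_cases h2 : k = x
      · rw [if_neg h1, if_pos h2, if_pos (by dsimp only; omega)]
        refine Prod.ext ?_ (Prod.ext ?_ ?_) <;> dsimp only <;> omega
      · rw [if_neg h1, if_neg h2, if_neg (by dsimp only; omega), if_neg (by dsimp only; omega)]
  -- The first two branches flip the parity of `k`, as `x` is odd; the last swaps distinct `k` and
  -- `x`.
  · rw [Finset.filter_false_of_mem]
    · rfl
    · rintro ⟨k, x, y⟩ ht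
      have hx := hodd k x y ht
      simp only [g]
      split_ifs <;> simp only [Prod.mk.injEq] <;> omega

/-- The congruence for all `N ≡ 2 (mod 4)` that are not sums of two squares. -/
theorem sum_sigma_zero_sub_sq_modEq {N : ℕ} (hN : N % 4 = 2) (hsq : ∀ x y, x ^ 2 + y ^ 2 ≠ N) :
    ∑ k ∈ (Finset.Icc 1 N).filter (fun k : ℕ => k ^ 2 < N), σ 0 (N - k ^ 2) ≡ 0 [MOD 4] := by
  have h1 : ∑ k ∈ (Finset.Icc 1 N).filter (fun k : ℕ => k ^ 2 < N), σ 0 (N - k ^ 2) ≡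
      ∑ k ∈ (Finset.Icc 1 N).filter (fun k : ℕ => k ^ 2 < N), 2 * (contributions N k).card
        [MOD 4] := by
    refine Nat.ModEq.sum fun k hk => ?_
    exact sigma_zero_sub_sq_modEq hN hsq (Finset.mem_filter.1 hk).2
  refine h1.trans ?_
  rw [← Finset.mul_sum]
  refine Nat.ModEq.mul_left' (n := 2) 2 (b := 0) ?_
  -- A contribution has `x > 0`, which forces `k² < N`, so the bound on `k` can be dropped.
  rw [Finset.sum_filter_of_ne]
  · exact sum_card_contributions_even hN
  · intro k _ hk
    obtain ⟨⟨x, y⟩, h⟩ := Finset.card_pos.1 (Nat.pos_of_ne_zero hk)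
    simp only [contributions, Finset.mem_filter, Finset.mem_product, Finset.mem_Icc] at h
    obtain ⟨⟨⟨hx, -⟩, -⟩, h⟩ := h
    have : 0 < x ^ 2 := by positivity
    split_ifs at h <;> omega

/-! ### The five progressions avoid sums of two squares -/

/-- A prime `p ≡ 3 (mod 4)` that divides `x² + y²` divides it twice. -/
theorem sq_dvd_of_dvd_sq_add_sq {p x y : ℕ} (hp : p.Prime) (h3 : p % 4 = 3)
    (h : p ∣ x ^ 2 + y ^ 2) : p ^ 2 ∣ x ^ 2 + y ^ 2 := by
  rcases Nat.eq_zero_or_pos (x ^ 2 + y ^ 2) with h0 | h0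
  · rw [h0]
    exact dvd_zero _
  have : Fact p.Prime := ⟨hp⟩
  have heven := Nat.eq_sq_add_sq_iff.1 ⟨x, y, rfl⟩ p (Nat.mem_primeFactors.2 ⟨hp, h, h0.ne'⟩) h3
  have hone := one_le_padicValNat_of_dvd h0.ne' h
  exact (padicValNat_dvd_iff_le h0.ne').2 (by obtain ⟨r, hr⟩ := heven; omega)

theorem theorem1p1 (A B n N : ℕ)
    (hAB : (A, B) ∈ ({(16, 14), (36, 30), (72, 42), (196, 70), (252, 114)} : Set (ℕ × ℕ)))
    (hN : N = A * n + B) :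
    ∑ k ∈ (Finset.Icc 1 N).filter (fun k : ℕ => (k : ℝ) < Real.sqrt (N : ℝ)),
      σ 0 (N - k ^ 2) ≡ 0 [MOD 4] := by
  have hfilter : (Finset.Icc 1 N).filter (fun k : ℕ => (k : ℝ) < Real.sqrt (N : ℝ)) =
      (Finset.Icc 1 N).filter (fun k : ℕ => k ^ 2 < N) := by
    refine Finset.filter_congr fun k _ => ?_
    rw [Real.lt_sqrt (Nat.cast_nonneg k)]
    exact_mod_cast Iff.rfl
  rw [hfilter]
  simp only [Set.mem_insert_iff, Set.mem_singleton_iff, Prod.mk.injEq] at hAB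
  refine sum_sigma_zero_sub_sq_modEq ?_ ?_
  · rcases hAB with h | h | h | h | h <;> obtain ⟨rfl, rfl⟩ := h <;> omega
  · intro x y hxy
    rcases hAB with h | h | h | h | h <;> obtain ⟨rfl, rfl⟩ := h
    -- Two squares never sum to 14 modulo 16. In the other progressions 3 or 7 divides `N` exactly
    -- once.
    · have hx : x ^ 2 % 16 ∈ ({0, 1, 4, 9} : Finset ℕ) := by
        rw [Nat.pow_mod]
        have := Nat.mod_lt x (show 16 > 0 by norm_num)
        interval_cases x % 16 <;> decide
      have hy : y ^ 2 % 16 ∈ ({0, 1, 4, 9} : Finset ℕ) := by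
        rw [Nat.pow_mod]
        have := Nat.mod_lt y (show 16 > 0 by norm_num)
        interval_cases y % 16 <;> decide
      simp only [Finset.mem_insert, Finset.mem_singleton] at hx hy
      omega
    · have := sq_dvd_of_dvd_sq_add_sq (p := 3) (by norm_num) rfl (x := x) (y := y) (by omega)
      omega
    · have := sq_dvd_of_dvd_sq_add_sq (p := 3) (by norm_num) rfl (x := x) (y := y) (by omega)
      omega
    · have := sq_dvd_of_dvd_sq_add_sq (p := 7) (by norm_num) rfl (x := x) (y := y) (by omega)
      omega
    · have := sq_dvd_of_dvd_sq_add_sq (p := 3) (by norm_num) rfl (x := x) (y := y) (by omega)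
      omega
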